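/- Let $H,K$ be complex Hilbert spaces. For $S\subseteq B(H,K)$ let $[S]^{-w^*}$ denote the weak-* (ultraweak) closure of the linear span of $S$. A TRO is a linear subspace $M\subseteq B(H,K)$ with $m_1m_2^*m_3\in M$ for all $m_1,m_2,m_3\in M$. For algebras $A\subseteq B(H)$ and $B\subseteq B(K)$, write $A\sim_{TRO}B$ (weak TRO-equivalence) if there is a TRO $M\subseteq B(H,K)$ with $$A=[M^*BM]^{-w^*},\qquad B=[MAM^*]^{-w^*}.$$ Write $B\subset_{TRO}A$ ($B$ weakly TRO-embeds into $A$) if there is a projection $p\in A$ with $B\sim_{TRO}pAp$, where $pAp$ is identified with the algebra $pA|_{p(H)}\subseteq B(p(H))$. Theorem. On the class of von Neumann algebras acting on complex Hilbert spaces (and containing the identity operator), $\subset_{TRO}$ is a partial order if TRO-equivalent algebras are identified. That is, for all von Neumann algebras $A,B,C$ acting on Hilbert spaces: (1) $\sim_{TRO}$ is an equivalence relation: $A\sim_{TRO}A$; $A\sim_{TRO}B$ implies $B\sim_{TRO}A$; $A\sim_{TRO}B$ and $B\sim_{TRO}C$ imply $A\sim_{TRO}C$. (2) $\subset_{TRO}$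 depends only on the $\sim_{TRO}$-classes: if $A\sim_{TRO}B$, then $A\subset_{TRO}C\iff B\subset_{TRO}C$ and $C\subset_{TRO}A\iff C\subset_{TRO}B$. (3) $\subset_{TRO}$ is reflexive, transitive, and antisymmetric up to $\sim_{TRO}$: $A\subset_{TRO}A$; $C\subset_{TRO}B$ and $B\subset_{TRO}A$ imply $C\subset_{TRO}A$; and $A\subset_{TRO}B$ and $B\subset_{TRO}A$ imply $A\sim_{TRO}B$. -/

import Mathlib

open scoped InnerProductSpace Topology

namespace TROMorita

section Definitions

variable {H : Type*} [NormedAddCommGroup H] [InnerProductSpace ℂ H] [CompleteSpace H]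
variable {K : Type*} [NormedAddCommGroup K] [InnerProductSpace ℂ K] [CompleteSpace K]

/-- The functional `T ↦ ∑ₙ ⟪yₙ, T xₙ⟫` on `B(H, K)` given by two square-summable sequences
`x` in `H` and `y` in `K`. These functionals are exactly the ones that come from the predual
(the trace class operators) of `B(H, K)`. The series always converges absolutely. -/
noncomputable def normalFunctional (x : lp (fun _ : ℕ => H) 2) (y : lp (fun _ : ℕ => K) 2)
    (T : H →L[ℂ] K) : ℂ :=
  ∑' n, ⟪y n, T (x n)⟫_ℂ

/-- The weak-* (ultraweak, `σ`-weak) topology of `B(H, K)`: the coarsest topology for which all the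
functionals `T ↦ ∑ₙ ⟪yₙ, T xₙ⟫` with square-summable `x`, `y` are continuous. -/
noncomputable abbrev weakStarTopology (H K : Type*) [NormedAddCommGroup H] [InnerProductSpace ℂ H]
    [NormedAddCommGroup K] [InnerProductSpace ℂ K] : TopologicalSpace (H →L[ℂ] K) :=
  ⨅ (x : lp (fun _ : ℕ => H) 2) (y : lp (fun _ : ℕ => K) 2),
    TopologicalSpace.induced (normalFunctional x y) inferInstance

/-- `[S]^{-w*}`: the weak-* closure of the linear span of `S ⊆ B(H, K)`. -/
def weakStarSpan (S : Set (H →L[ℂ] K)) : Set (H →L[ℂ] K) :=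
  closure[weakStarTopology H K] (Submodule.span ℂ S : Set (H →L[ℂ] K))

/-- A ternary ring of operators: a linear subspace `M` of `B(H, K)` with `M M* M ⊆ M`. -/
def IsTRO (M : Submodule ℂ (H →L[ℂ] K)) : Prop :=
  ∀ m₁ ∈ M, ∀ m₂ ∈ M, ∀ m₃ ∈ M, m₁ ∘L m₂.adjoint ∘L m₃ ∈ M

/-- Weak TRO-equivalence `A ∼_TRO B` of operator algebras `A ⊆ B(H)` and `B ⊆ B(K)`: there is a TRO
`M ⊆ B(H, K)` with `A = [M* B M]^{-w*}` and `B = [M A M*]^{-w*}`. -/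
def TROEquiv (A : Set (H →L[ℂ] H)) (B : Set (K →L[ℂ] K)) : Prop :=
  ∃ M : Submodule ℂ (H →L[ℂ] K), IsTRO M ∧
    A = weakStarSpan {T | ∃ m ∈ M, ∃ b ∈ B, ∃ n ∈ M, T = m.adjoint ∘L b ∘L n} ∧
    B = weakStarSpan {T | ∃ m ∈ M, ∃ a ∈ A, ∃ n ∈ M, T = m ∘L a ∘L n.adjoint}

/-- The range of a projection in `B(H)` is a Hilbert space. -/
theorem completeSpace_range {p : H →L[ℂ] H} (hp : IsStarProjection p) :
    CompleteSpace p.range := by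
  have h : IsClosed (p.range : Set H) := ContinuousLinearMap.IsIdempotentElem.isClosed_range hp.isIdempotentElem
  exact h.completeSpace_coe

/-- The algebra `pAp`, identified with the algebra `pA|_{p(H)}` of operators on the Hilbert space
`p(H)`. -/
def corner (A : Set (H →L[ℂ] H)) (p : H →L[ℂ] H) : Set (p.range →L[ℂ] p.range) :=
  {b | ∃ a ∈ A, ∀ ξ : p.range, (b ξ : H) = p (a ξ)}

/-- `TROEmbeds B A` is the relation `B ⊂_TRO A`: there is a projection `p ∈ A` such that `B` is
weakly TRO-equivalent to `pAp ⊆ B(p(H))`. -/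
def TROEmbeds (B : Set (K →L[ℂ] K)) (A : Set (H →L[ℂ] H)) : Prop :=
  ∃ p ∈ A, ∃ hp : IsStarProjection p,
    haveI : CompleteSpace p.range := completeSpace_range hp
    TROEquiv B (corner A p)

end Definitions

end TROMorita

/-! Both relations reduce to the existence of a `B`-`A`-bimodule `M` with `M*M ⊆ A` and `MM* ⊆ B`, a
correspondence. Equivalence means that `M` and `M*` both have zero common kernel (`troEquiv_iff`);
embedding of `A` into `B` asks this of `M` only (`troEmbeds_iff`). No closure of `M` is needed: if
`M` is jointly injective, `span M*M` is a nondegenerate *-algebra, so its weak-* closure contains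
`1`, and `AM*M` is then weak-* dense in `A`.

After this reduction symmetry is passage to adjoints, transitivity is the product `NM`, and an
equivalence is visibly an embedding; hence embeddings depend only on equivalence classes.

Antisymmetry is a Cantor–Bernstein argument. Given jointly injective `M` from `A` to `B` and `N`
from `B` to `A`, the Knaster–Tarski theorem yields subspaces with `F = (MG)ᗮ` and `G = (NF)ᗮ`. Their
projections `g`, `f` are central, and the span of `Mg + fN*` is a correspondence injective on both
sides: `Mg` pairs `G` with `Fᗮ`, and `fN*` pairs `Gᗮ` with `F`. -/

namespace TROMorita

/-! ### Weak-* topology: continuity of the basic operations and closed spans -/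

section WeakStar

open Filter

theorem summable_norm_mul_norm {H K : Type*} [NormedAddCommGroup H] [NormedAddCommGroup K]
    (x : lp (fun _ : ℕ => H) 2) (y : lp (fun _ : ℕ => K) 2) :
    Summable fun n => ‖y n‖ * ‖x n‖ := by
  have hx := (lp.memℓp x).summable (by norm_num)
  have hy := (lp.memℓp y).summable (by norm_num)
  refine Summable.of_nonneg_of_le (fun n => by positivity) (fun n => ?_) (hx.add hy)
  have h := two_mul_le_add_sq ‖y n‖ ‖x n‖
  have h0 : 0 ≤ ‖y n‖ * ‖x n‖ := by positivity
  simp only [ENNReal.toReal_ofNat, Real.rpow_ofNat]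
  linarith

variable {H : Type*} [NormedAddCommGroup H] [InnerProductSpace ℂ H]
variable {K : Type*} [NormedAddCommGroup K] [InnerProductSpace ℂ K]
variable {H' : Type*} [NormedAddCommGroup H'] [InnerProductSpace ℂ H']
variable {K' : Type*} [NormedAddCommGroup K'] [InnerProductSpace ℂ K']

theorem norm_inner_apply_le (T : H →L[ℂ] K) (ξ : H) (η : K) :
    ‖⟪η, T ξ⟫_ℂ‖ ≤ ‖T‖ * (‖η‖ * ‖ξ‖) :=
  calc ‖⟪η, T ξ⟫_ℂ‖ ≤ ‖η‖ * ‖T ξ‖ := norm_inner_le_norm _ _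
    _ ≤ ‖η‖ * (‖T‖ * ‖ξ‖) := by gcongr; exact T.le_opNorm ξ
    _ = _ := by ring

theorem summable_normalFunctional (x : lp (fun _ : ℕ => H) 2) (y : lp (fun _ : ℕ => K) 2)
    (T : H →L[ℂ] K) : Summable fun n => ⟪y n, T (x n)⟫_ℂ :=
  Summable.of_norm_bounded ((summable_norm_mul_norm x y).mul_left ‖T‖)
    fun _ => norm_inner_apply_le _ _ _

theorem normalFunctional_add (x : lp (fun _ : ℕ => H) 2) (y : lp (fun _ : ℕ => K) 2)
    (S T : H →L[ℂ] K) :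
    normalFunctional x y (S + T) = normalFunctional x y S + normalFunctional x y T := by
  simp only [normalFunctional, add_apply, inner_add_right]
  exact (summable_normalFunctional x y S).tsum_add (summable_normalFunctional x y T)

theorem normalFunctional_smul (x : lp (fun _ : ℕ => H) 2) (y : lp (fun _ : ℕ => K) 2)
    (c : ℂ) (T : H →L[ℂ] K) :
    normalFunctional x y (c • T) = c * normalFunctional x y T := by
  simp only [normalFunctional, smul_apply, inner_smul_right]
  exact tsum_mul_left

theorem continuous_normalFunctional (x : lp (fun _ : ℕ => H) 2) (y : lp (fun _ : ℕ => K) 2) :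
    Continuous[weakStarTopology H K, inferInstance] (normalFunctional x y) :=
  continuous_iInf_dom (continuous_iInf_dom continuous_induced_dom)

theorem continuous_weakStar_rng {X : Type*} {t : TopologicalSpace X} {f : X → (H →L[ℂ] K)}
    (h : ∀ x y, Continuous fun a => normalFunctional x y (f a)) :
    Continuous[t, weakStarTopology H K] f :=
  continuous_iInf_rng.2 fun x => continuous_iInf_rng.2 fun y => continuous_induced_rng.2 (h x y)

theorem continuousAdd_weakStar : @ContinuousAdd (H →L[ℂ] K) (weakStarTopology H K) _ := by
  let := weakStarTopology H K
  refine ⟨continuous_weakStar_rng fun x y => ?_⟩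
  simp only [normalFunctional_add]
  exact ((continuous_normalFunctional x y).comp continuous_fst).add
    ((continuous_normalFunctional x y).comp continuous_snd)

theorem continuousConstSMul_weakStar :
    @ContinuousConstSMul ℂ (H →L[ℂ] K) (weakStarTopology H K) _ := by
  let := weakStarTopology H K
  refine ⟨fun c => continuous_weakStar_rng fun x y => ?_⟩
  simp only [normalFunctional_smul]
  exact continuous_const.mul (continuous_normalFunctional x y)

/-- Each normal functional is bounded by `∑ ‖yₙ‖‖xₙ‖`. This lets norm closures be absorbed into
weak-* closures. -/
theorem norm_topology_le_weakStar :
    (inferInstance : TopologicalSpace (H →L[ℂ] K)) ≤ weakStarTopology H K := by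
  rw [← continuous_id_iff_le]
  refine continuous_weakStar_rng fun x y => ?_
  let f : (H →L[ℂ] K) →ₗ[ℂ] ℂ :=
    { toFun := normalFunctional x y
      map_add' := normalFunctional_add x y
      map_smul' := normalFunctional_smul x y }
  refine AddMonoidHomClass.continuous_of_bound f (∑' n, ‖y n‖ * ‖x n‖) fun T => ?_
  rw [mul_comm, ← tsum_mul_left]
  exact tsum_of_norm_bounded ((summable_norm_mul_norm x y).mul_left ‖T‖).hasSum
    fun _ => norm_inner_apply_le _ _ _

theorem memℓp_two_comp (Q : H →L[ℂ] K) (x : lp (fun _ : ℕ => H) 2) :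
    Memℓp (fun n => Q (x n)) 2 := by
  have hx := (lp.memℓp x).summable (by norm_num)
  refine memℓp_gen (Summable.of_nonneg_of_le (fun n => by positivity) (fun n => ?_)
    (hx.mul_left (‖Q‖ ^ 2)))
  simp only [ENNReal.toReal_ofNat, Real.rpow_ofNat]
  rw [← mul_pow]
  gcongr
  exact Q.le_opNorm _

/-- Two-sided multiplication is weak-* continuous. -/
theorem continuous_weakStar_comp [CompleteSpace K] [CompleteSpace K']
    (R : K →L[ℂ] K') (Q : H' →L[ℂ] H) :
    Continuous[weakStarTopology H K, weakStarTopology H' K'] fun T => R ∘L T ∘L Q := by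
  refine continuous_weakStar_rng (t := weakStarTopology H K) fun x y => ?_
  -- The functional given by `x`, `y` pulls back to the one given by `Qxₙ` and `R*yₙ`.
  convert continuous_normalFunctional (⟨_, memℓp_two_comp Q x⟩ : lp (fun _ : ℕ => H) 2)
    (⟨_, memℓp_two_comp R.adjoint y⟩ : lp (fun _ : ℕ => K) 2) using 2 with T
  simp [normalFunctional, ContinuousLinearMap.adjoint_inner_left]

theorem continuous_weakStar_inner (ξ : H) (η : K) :
    Continuous[weakStarTopology H K, inferInstance] fun T : H →L[ℂ] K => ⟪η, T ξ⟫_ℂ := by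
  classical
  convert continuous_normalFunctional (lp.single 2 0 ξ) (lp.single 2 0 η) using 2 with T
  rw [normalFunctional, tsum_eq_single 0]
  · simp
  · intro n hn
    simp [lp.single_apply, hn]

/-- The weak-* closed linear span, as a submodule. -/
noncomputable def weakStarSpanSubmodule (S : Set (H →L[ℂ] K)) : Submodule ℂ (H →L[ℂ] K) :=
  @Submodule.topologicalClosure ℂ (H →L[ℂ] K) _ (weakStarTopology H K) _ _
    continuousConstSMul_weakStar continuousAdd_weakStar (Submodule.span ℂ S)

theorem isClosed_weakStarSpan (S : Set (H →L[ℂ] K)) :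
    IsClosed[weakStarTopology H K] (weakStarSpan S) :=
  @isClosed_closure _ (weakStarTopology H K) _

theorem subset_weakStarSpan (S : Set (H →L[ℂ] K)) : S ⊆ weakStarSpan S :=
  Submodule.subset_span.trans (@subset_closure _ (weakStarTopology H K) _)

theorem weakStarSpan_subset {S : Set (H →L[ℂ] K)} {N : Submodule ℂ (H →L[ℂ] K)}
    (hN : IsClosed[weakStarTopology H K] (N : Set (H →L[ℂ] K))) (h : S ⊆ N) :
    weakStarSpan S ⊆ N :=
  @closure_minimal _ (weakStarTopology H K) _ _
    (show (Submodule.span ℂ S : Set (H →L[ℂ] K)) ⊆ N from Submodule.span_le.2 h) hN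

/-- Two-sided multiplication sends the weak-* closed span of `S` into any weak-* closed
submodule containing the image of `S`. -/
theorem comp_mem_of_mem_weakStarSpan [CompleteSpace K] [CompleteSpace K']
    {S : Set (H →L[ℂ] K)} {N : Submodule ℂ (H' →L[ℂ] K')}
    (hN : IsClosed[weakStarTopology H' K'] (N : Set (H' →L[ℂ] K')))
    (R : K →L[ℂ] K') (Q : H' →L[ℂ] H) (h : ∀ T ∈ S, R ∘L T ∘L Q ∈ N)
    {T : H →L[ℂ] K} (hT : T ∈ weakStarSpan S) : R ∘L T ∘L Q ∈ N := by
  let f : (H →L[ℂ] K) →ₗ[ℂ] (H' →L[ℂ] K') :=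
    { toFun := fun T => R ∘L T ∘L Q
      map_add' := fun _ _ => by ext; simp
      map_smul' := fun _ _ => by ext; simp }
  exact weakStarSpan_subset (N := N.comap f)
    (@IsClosed.preimage _ _ (weakStarTopology H K) (weakStarTopology H' K') f
      (continuous_weakStar_comp R Q) _ hN) h hT

/-- Applied to the identity operator, this turns `1 ∈ [S]^{-w*}` into a statement that `S` has no
common kernel. -/
theorem apply_eq_zero_of_mem_weakStarSpan {S : Set (H →L[ℂ] K)} {ξ : H}
    (h : ∀ T ∈ S, T ξ = 0) {T : H →L[ℂ] K} (hT : T ∈ weakStarSpan S) : T ξ = 0 := by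
  refine ext_inner_left ℂ fun η => ?_
  rw [inner_zero_right]
  have hc : IsClosed[weakStarTopology H K] {T : H →L[ℂ] K | ⟪η, T ξ⟫_ℂ = 0} :=
    @IsClosed.preimage _ _ (weakStarTopology H K) _ _ (continuous_weakStar_inner ξ η) _
      isClosed_singleton
  let f : (H →L[ℂ] K) →ₗ[ℂ] ℂ :=
    { toFun := fun T => ⟪η, T ξ⟫_ℂ
      map_add' := fun _ _ => by simp
      map_smul' := fun _ _ => by simp }
  exact weakStarSpan_subset (N := LinearMap.ker f) hc (fun T hT => by simp [f, h T hT]) hT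

end WeakStar

/-! ### Approximate units and the identity in a weak-* closure -/

section ApproximateUnit

open Filter

variable {H : Type*} [NormedAddCommGroup H] [InnerProductSpace ℂ H]

/-- A bounded net that converges strongly converges weak-*. -/
theorem tendsto_normalFunctional {ι : Type*} {l : Filter ι} {e : ι → (H →L[ℂ] H)}
    {T : H →L[ℂ] H} (hb : ∀ᶠ i in l, ‖e i‖ ≤ 1) (h : ∀ ξ, Tendsto (fun i => e i ξ) l (𝓝 (T ξ)))
    (x y : lp (fun _ : ℕ => H) 2) :
    Tendsto (fun i => normalFunctional x y (e i)) l (𝓝 (normalFunctional x y T)) := by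
  refine tendsto_tsum_of_dominated_convergence (summable_norm_mul_norm x y)
    (fun n => tendsto_const_nhds.inner (h (x n))) ?_
  filter_upwards [hb] with i hi n
  exact (norm_inner_apply_le _ _ _).trans (mul_le_of_le_one_left (by positivity) hi)

theorem tendsto_apply_of_dense {ι : Type*} {l : Filter ι} {e : ι → (H →L[ℂ] H)}
    (hb : ∀ᶠ i in l, ‖e i‖ ≤ 1) {D : Set H} (hD : Dense D)
    (h : ∀ ξ ∈ D, Tendsto (fun i => e i ξ) l (𝓝 ξ)) (ξ : H) :
    Tendsto (fun i => e i ξ) l (𝓝 ξ) := by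
  rw [Metric.tendsto_nhds]
  intro ε hε
  obtain ⟨v, hv, hv'⟩ := hD.exists_dist_lt ξ (show 0 < ε / 3 by positivity)
  filter_upwards [hb, Metric.tendsto_nhds.1 (h v hv) (ε / 3) (by positivity)] with i hi hiv
  have h1 : dist (e i ξ) (e i v) ≤ dist ξ v := by
    rw [dist_eq_norm, dist_eq_norm, ← map_sub]
    exact ((e i).le_opNorm _).trans (mul_le_of_le_one_left (norm_nonneg _) hi)
  have h2 := dist_triangle4 (e i ξ) (e i v) v ξ
  rw [dist_comm v ξ] at h2
  linarith

/-- A nondegenerate *-algebra of operators has the identity in its weak-* closure. -/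
theorem one_mem_weakStar_closure [CompleteSpace H] (J : NonUnitalStarSubalgebra ℂ (H →L[ℂ] H))
    (hJ : ∀ ξ : H, (∀ j ∈ J, j ξ = 0) → ξ = 0) :
    (1 : H →L[ℂ] H) ∈ closure[weakStarTopology H H] (J : Set (H →L[ℂ] H)) := by
  -- The norm closure is a C*-algebra, so it has a contractive approximate unit.
  let J' := J.topologicalClosure
  have : IsClosed (J' : Set (H →L[ℂ] H)) := J.isClosed_topologicalClosure
  let : NonUnitalCStarAlgebra J' := NonUnitalStarSubalgebra.nonUnitalCStarAlgebra J'
  let : PartialOrder J' := CStarAlgebra.spectralOrder J'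
  have : StarOrderedRing J' := CStarAlgebra.spectralOrderedRing J'
  have hl := CStarAlgebra.increasingApproximateUnit J'
  have hne := hl.neBot
  set l := CStarAlgebra.approximateUnit J'
  have hb : ∀ᶠ e : J' in l, ‖(e : H →L[ℂ] H)‖ ≤ 1 := hl.eventually_norm
  -- `JH` spans a dense subspace: since `J = J*`, a vector orthogonal to it is killed by `J`. On
  -- `JH` the approximate unit converges strongly to `1`, because `ej → j` in norm.
  let D : Submodule ℂ H := Submodule.span ℂ {ζ | ∃ j ∈ J, ∃ ξ, ζ = j ξ}
  have hD : Dense (D : Set H) := by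
    rw [Submodule.dense_iff_topologicalClosure_eq_top, Submodule.topologicalClosure_eq_top_iff,
      Submodule.eq_bot_iff]
    intro η hη
    refine hJ η fun j hj => ext_inner_left ℂ fun ζ => ?_
    rw [inner_zero_right, ← ContinuousLinearMap.adjoint_inner_left]
    exact (Submodule.mem_orthogonal D η).1 hη _
      (Submodule.subset_span ⟨_, star_mem hj, ζ, rfl⟩)
  have hs : ∀ ξ ∈ D, Tendsto (fun e : J' => (e : H →L[ℂ] H) ξ) l (𝓝 ξ) := by
    intro ξ hξ
    induction hξ using Submodule.span_induction with
    | mem ξ h =>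
      obtain ⟨j, hj, ζ, rfl⟩ := h
      have h1 := hl.tendsto_mul_right ⟨j, J.le_topologicalClosure hj⟩
      have h2 : Continuous fun a : J' => (a : H →L[ℂ] H) ζ := by fun_prop
      exact (h2.tendsto _).comp h1
    | zero => simp
    | add a b _ _ ha hb => simpa using ha.add hb
    | smul c a _ ha => simpa using ha.const_smul c
  have hs' := tendsto_apply_of_dense hb hD hs
  have hlim : Tendsto (fun e : J' => (e : H →L[ℂ] H)) l (@nhds _ (weakStarTopology H H) 1) := by
    simp only [nhds_iInf, nhds_induced, tendsto_iInf, tendsto_comap_iff]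
    exact fun x y => tendsto_normalFunctional hb hs' x y
  have h1 : (1 : H →L[ℂ] H) ∈ closure[weakStarTopology H H] (J' : Set (H →L[ℂ] H)) :=
    @mem_closure_of_tendsto _ (weakStarTopology H H) _ _ _ _ _ hne hlim
      (Eventually.of_forall fun e => e.2)
  have h2 : (J' : Set (H →L[ℂ] H)) ⊆ closure[weakStarTopology H H] (J : Set (H →L[ℂ] H)) :=
    closure.mono norm_topology_le_weakStar
  exact Set.mem_of_subset_of_mem (@closure_minimal _ (weakStarTopology H H) _ _ h2
    (@isClosed_closure _ (weakStarTopology H H) _)) h1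

end ApproximateUnit

/-! ### Ternary rings of operators and density of `M*M` -/

section TRO

variable {H : Type*} [NormedAddCommGroup H] [InnerProductSpace ℂ H] [CompleteSpace H]
variable {K : Type*} [NormedAddCommGroup K] [InnerProductSpace ℂ K] [CompleteSpace K]

/-- The common kernel of the operators in `M` is zero. -/
def JointlyInjective (M : Submodule ℂ (H →L[ℂ] K)) : Prop :=
  ∀ ξ, (∀ m ∈ M, m ξ = 0) → ξ = 0

theorem adjoint_smul (c : ℂ) (T : H →L[ℂ] K) :
    (c • T).adjoint = starRingEnd ℂ c • T.adjoint :=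
  ContinuousLinearMap.adjoint.map_smulₛₗ c T

/-- The space `M*` of adjoints of operators in `M`. -/
noncomputable def adjointSubmodule (M : Submodule ℂ (H →L[ℂ] K)) : Submodule ℂ (K →L[ℂ] H) where
  carrier := {T | T.adjoint ∈ M}
  zero_mem' := by simp
  add_mem' hS hT := by simpa using M.add_mem hS hT
  smul_mem' c T hT := by simpa [adjoint_smul] using M.smul_mem _ hT

theorem mem_adjointSubmodule {M : Submodule ℂ (H →L[ℂ] K)} {T : K →L[ℂ] H} :
    T ∈ adjointSubmodule M ↔ T.adjoint ∈ M := Iff.rfl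

theorem adjoint_mem_adjointSubmodule {M : Submodule ℂ (H →L[ℂ] K)} {m : H →L[ℂ] K}
    (hm : m ∈ M) : m.adjoint ∈ adjointSubmodule M := by
  simpa [mem_adjointSubmodule] using hm

theorem apply_eq_zero_of_adjoint_apply_apply {m : H →L[ℂ] K} {ξ : H}
    (h : m.adjoint (m ξ) = 0) : m ξ = 0 := by
  rw [← inner_self_eq_zero (𝕜 := ℂ), ← ContinuousLinearMap.adjoint_inner_left, h, inner_zero_left]

theorem IsTRO.adjoint {M : Submodule ℂ (H →L[ℂ] K)} (hM : IsTRO M) :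
    IsTRO (adjointSubmodule M) := by
  intro a ha b hb c hc
  simpa [mem_adjointSubmodule, ContinuousLinearMap.adjoint_comp, ContinuousLinearMap.comp_assoc]
    using hM _ hc _ hb _ ha

/-- The *-algebra `span M*M` of a TRO. -/
noncomputable def IsTRO.rightAlgebra {M : Submodule ℂ (H →L[ℂ] K)} (hM : IsTRO M) :
    NonUnitalStarSubalgebra ℂ (H →L[ℂ] H) where
  carrier := Submodule.span ℂ {T | ∃ m ∈ M, ∃ n ∈ M, T = m.adjoint ∘L n}
  zero_mem' := Submodule.zero_mem _
  add_mem' := Submodule.add_mem _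
  smul_mem' c _ := Submodule.smul_mem _ c
  mul_mem' {a b} ha hb := by
    have h := Submodule.mul_mem_mul ha hb
    rw [Submodule.span_mul_span] at h
    refine Submodule.span_mono ?_ h
    rintro _ ⟨_, ⟨m, hm, n, hn, rfl⟩, _, ⟨m', hm', n', hn', rfl⟩, rfl⟩
    -- `(m*n)(m'*n') = m*(n m'* n')`, and the bracket lies in `M`.
    exact ⟨m, hm, _, hM n hn m' hm' n' hn', rfl⟩
  star_mem' {a} ha := by
    induction ha using Submodule.span_induction with
    | mem a h =>
      obtain ⟨m, hm, n, hn, rfl⟩ := h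
      refine Submodule.subset_span ⟨n, hn, m, hm, ?_⟩
      rw [ContinuousLinearMap.star_eq_adjoint, ContinuousLinearMap.adjoint_comp,
        ContinuousLinearMap.adjoint_adjoint]
    | zero => simp
    | add a b _ _ ha hb => rw [star_add]; exact Submodule.add_mem _ ha hb
    | smul c a _ ha => rw [star_smul]; exact Submodule.smul_mem _ _ ha

theorem IsTRO.one_mem_weakStarSpan {M : Submodule ℂ (H →L[ℂ] K)} (hM : IsTRO M)
    (hi : JointlyInjective M) :
    (1 : H →L[ℂ] H) ∈ weakStarSpan {T | ∃ m ∈ M, ∃ n ∈ M, T = m.adjoint ∘L n} := by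
  refine one_mem_weakStar_closure hM.rightAlgebra fun ξ h => hi ξ fun m hm => ?_
  exact apply_eq_zero_of_adjoint_apply_apply (h _ (Submodule.subset_span ⟨m, hm, m, hm, rfl⟩))

/-- If `M` is a jointly injective TRO and `a M*M ⊆ T`, then `a` is in the weak-* closed span of
`T`. -/
theorem IsTRO.mem_weakStarSpan {M : Submodule ℂ (H →L[ℂ] K)} (hM : IsTRO M)
    (hi : JointlyInjective M) {a : H →L[ℂ] H} {S : Set (H →L[ℂ] H)}
    (h : ∀ m ∈ M, ∀ n ∈ M, a ∘L m.adjoint ∘L n ∈ S) : a ∈ weakStarSpan S := by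
  -- Left multiplication by `a` is weak-* continuous; it is applied to `1 ∈ [M*M]^{-w*}`.
  refine comp_mem_of_mem_weakStarSpan (N := weakStarSpanSubmodule S) (isClosed_weakStarSpan S) a 1
    ?_ (hM.one_mem_weakStarSpan hi)
  rintro _ ⟨m, hm, n, hn, rfl⟩
  exact subset_weakStarSpan S (h m hm n hn)

end TRO

/-! ### Von Neumann algebras: weak-* closedness and projections -/

section VonNeumann

variable {H : Type*} [NormedAddCommGroup H] [InnerProductSpace ℂ H] [CompleteSpace H]

/-- The underlying linear subspace of a von Neumann algebra. -/
noncomputable def vnSubmodule (A : VonNeumannAlgebra H) : Submodule ℂ (H →L[ℂ] H) :=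
  Subalgebra.toSubmodule A.toStarSubalgebra.toSubalgebra

theorem mem_vnSubmodule {A : VonNeumannAlgebra H} {a : H →L[ℂ] H} :
    a ∈ vnSubmodule A ↔ a ∈ A := Iff.rfl

theorem coe_vnSubmodule (A : VonNeumannAlgebra H) :
    (vnSubmodule A : Set (H →L[ℂ] H)) = A := rfl

theorem mem_of_commute {A : VonNeumannAlgebra H} {a : H →L[ℂ] H}
    (h : ∀ t ∈ A.commutant, t * a = a * t) : a ∈ A := by
  rw [← A.commutant_commutant, VonNeumannAlgebra.mem_commutant_iff]
  exact h

/-- By the double commutant property, membership is a family of equations between weak-* continuous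
vector functionals. -/
theorem isClosed_vnSubmodule (A : VonNeumannAlgebra H) :
    IsClosed[weakStarTopology H H] (vnSubmodule A : Set (H →L[ℂ] H)) := by
  rw [coe_vnSubmodule]
  have h : (A : Set (H →L[ℂ] H)) = ⋂ t ∈ A.commutant, ⋂ (ξ : H) (η : H),
      {T : H →L[ℂ] H | ⟪t.adjoint η, T ξ⟫_ℂ = ⟪η, T (t ξ)⟫_ℂ} := by
    ext T
    simp only [Set.mem_iInter, Set.mem_ofPred_eq, SetLike.mem_coe,
      ContinuousLinearMap.adjoint_inner_left]
    constructor
    · intro hT t ht ξ η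
      have := VonNeumannAlgebra.mem_commutant_iff.1 ht T hT
      exact congrArg (fun S : H →L[ℂ] H => ⟪η, S ξ⟫_ℂ) this.symm
    · intro hT
      refine mem_of_commute fun t ht => ?_
      ext ξ
      exact ext_inner_left ℂ fun η => hT t ht ξ η
  rw [h]
  let := weakStarTopology H H
  refine isClosed_biInter fun t _ => isClosed_iInter fun ξ => isClosed_iInter fun η => ?_
  exact isClosed_eq (continuous_weakStar_inner _ _) (continuous_weakStar_inner _ _)

/-- `G` is invariant under the commutant of `A`. -/
def CommutantInvariant (A : VonNeumannAlgebra H) (G : Submodule ℂ H) : Prop :=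
  ∀ t ∈ A.commutant, ∀ ξ ∈ G, t ξ ∈ G

theorem CommutantInvariant.sSup {A : VonNeumannAlgebra H} {s : Set (Submodule ℂ H)}
    (h : ∀ G ∈ s, CommutantInvariant A G) : CommutantInvariant A (sSup s) := by
  intro t ht
  have : SupSet.sSup s ≤ (SupSet.sSup s).comap (t : H →ₗ[ℂ] H) :=
    sSup_le fun G hG ξ hξ => (le_sSup hG : G ≤ SupSet.sSup s) (h G hG t ht ξ hξ)
  exact fun ξ hξ => this hξ

theorem CommutantInvariant.topologicalClosure {A : VonNeumannAlgebra H} {G : Submodule ℂ H}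
    (h : CommutantInvariant A G) : CommutantInvariant A G.topologicalClosure :=
  fun t ht _ hξ => map_mem_closure t.continuous hξ (h t ht)

theorem CommutantInvariant.starProjection_mem {A : VonNeumannAlgebra H} {G : Submodule ℂ H}
    [CompleteSpace G] (h : CommutantInvariant A G) : G.starProjection ∈ A := by
  rw [VonNeumannAlgebra.IsStarProjection.mem_iff isStarProjection_starProjection]
  intro t ht
  rw [Submodule.range_starProjection]
  exact fun ξ hξ => h t ht ξ hξ

end VonNeumann

/-! ### Products of operator spaces -/

section Product

variable {H : Type*} [NormedAddCommGroup H] [InnerProductSpace ℂ H]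
variable {K : Type*} [NormedAddCommGroup K] [InnerProductSpace ℂ K]
variable {L : Type*} [NormedAddCommGroup L] [InnerProductSpace ℂ L]

/-- The product `NM` of two spaces of operators. -/
def compSubmodule (N : Submodule ℂ (K →L[ℂ] L)) (M : Submodule ℂ (H →L[ℂ] K)) :
    Submodule ℂ (H →L[ℂ] L) :=
  Submodule.span ℂ {T | ∃ n ∈ N, ∃ m ∈ M, T = n ∘L m}

theorem comp_mem_compSubmodule {N : Submodule ℂ (K →L[ℂ] L)} {M : Submodule ℂ (H →L[ℂ] K)}
    {n : K →L[ℂ] L} {m : H →L[ℂ] K} (hn : n ∈ N) (hm : m ∈ M) : n ∘L m ∈ compSubmodule N M :=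
  Submodule.subset_span ⟨n, hn, m, hm, rfl⟩

theorem JointlyInjective.comp {N : Submodule ℂ (K →L[ℂ] L)} {M : Submodule ℂ (H →L[ℂ] K)}
    (hN : JointlyInjective N) (hM : JointlyInjective M) : JointlyInjective (compSubmodule N M) :=
  fun ξ h => hM ξ fun _ hm => hN _ fun _ hn => h _ (comp_mem_compSubmodule hn hm)

end Product

/-! ### Correspondences and weak TRO-equivalence -/

section Correspondence

variable {H : Type*} [NormedAddCommGroup H] [InnerProductSpace ℂ H] [CompleteSpace H]
variable {K : Type*} [NormedAddCommGroup K] [InnerProductSpace ℂ K] [CompleteSpace K]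
variable {L : Type*} [NormedAddCommGroup L] [InnerProductSpace ℂ L] [CompleteSpace L]
variable {A : VonNeumannAlgebra H} {B : VonNeumannAlgebra K} {C : VonNeumannAlgebra L}

/-- A `B`-`A`-bimodule `M ⊆ B(H, K)` with `M*M ⊆ A` and `MM* ⊆ B`. -/
structure IsCorrespondence (A : VonNeumannAlgebra H) (B : VonNeumannAlgebra K)
    (M : Submodule ℂ (H →L[ℂ] K)) : Prop where
  comp_left : ∀ b ∈ B, ∀ m ∈ M, b ∘L m ∈ M
  comp_right : ∀ m ∈ M, ∀ a ∈ A, m ∘L a ∈ M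
  adjoint_comp : ∀ m ∈ M, ∀ n ∈ M, m.adjoint ∘L n ∈ A
  comp_adjoint : ∀ m ∈ M, ∀ n ∈ M, m ∘L n.adjoint ∈ B

theorem adjoint_mem {a : H →L[ℂ] H} (ha : a ∈ A) : a.adjoint ∈ A := star_mem ha

theorem comp_mem {a b : H →L[ℂ] H} (ha : a ∈ A) (hb : b ∈ A) : a ∘L b ∈ A := mul_mem ha hb

/-- All four conditions are linear or conjugate-linear in each element of the bimodule, so a
generating set suffices. -/
theorem IsCorrespondence.span {S : Set (H →L[ℂ] K)}
    (hl : ∀ b ∈ B, ∀ m ∈ S, b ∘L m ∈ S) (hr : ∀ m ∈ S, ∀ a ∈ A, m ∘L a ∈ S)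
    (ha : ∀ m ∈ S, ∀ n ∈ S, m.adjoint ∘L n ∈ A) (hb : ∀ m ∈ S, ∀ n ∈ S, m ∘L n.adjoint ∈ B) :
    IsCorrespondence A B (Submodule.span ℂ S) where
  comp_left b hbB m hm := by
    induction hm using Submodule.span_induction with
    | mem m h => exact Submodule.subset_span (hl b hbB m h)
    | zero => simp
    | add m n _ _ hm hn => simpa using Submodule.add_mem _ hm hn
    | smul c m _ hm => simpa using Submodule.smul_mem _ c hm
  comp_right m hm a haA := by
    induction hm using Submodule.span_induction with
    | mem m h => exact Submodule.subset_span (hr m h a haA)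
    | zero => simp
    | add m n _ _ hm hn => simpa using Submodule.add_mem _ hm hn
    | smul c m _ hm => simpa using Submodule.smul_mem _ c hm
  adjoint_comp m hm n hn := by
    rw [← mem_vnSubmodule]
    induction hm using Submodule.span_induction with
    | mem m h =>
      induction hn using Submodule.span_induction with
      | mem n h' => exact ha m h n h'
      | zero => simp
      | add _ _ _ _ h1 h2 => simpa using Submodule.add_mem _ h1 h2
      | smul c _ _ h1 => simpa using Submodule.smul_mem _ c h1
    | zero => simp
    | add _ _ _ _ h1 h2 => simpa using Submodule.add_mem _ h1 h2
    | smul c _ _ h1 => 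
      simpa [adjoint_smul] using Submodule.smul_mem _ (starRingEnd ℂ c) h1
  comp_adjoint m hm n hn := by
    rw [← mem_vnSubmodule]
    induction hm using Submodule.span_induction with
    | mem m h =>
      induction hn using Submodule.span_induction with
      | mem n h' => exact hb m h n h'
      | zero => simp
      | add _ _ _ _ h1 h2 => simpa using Submodule.add_mem _ h1 h2
      | smul c _ _ h1 => 
      simpa [adjoint_smul] using Submodule.smul_mem _ (starRingEnd ℂ c) h1
    | zero => simp
    | add _ _ _ _ h1 h2 => simpa using Submodule.add_mem _ h1 h2
    | smul c _ _ h1 => simpa using Submodule.smul_mem _ c h1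

theorem IsCorrespondence.isTRO {M : Submodule ℂ (H →L[ℂ] K)} (hM : IsCorrespondence A B M) :
    IsTRO M :=
  fun m₁ h₁ m₂ h₂ m₃ h₃ => hM.comp_right m₁ h₁ _ (hM.adjoint_comp m₂ h₂ m₃ h₃)

theorem IsCorrespondence.adjoint {M : Submodule ℂ (H →L[ℂ] K)} (hM : IsCorrespondence A B M) :
    IsCorrespondence B A (adjointSubmodule M) where
  comp_left a ha m hm := by
    rw [mem_adjointSubmodule, ContinuousLinearMap.adjoint_comp]
    exact hM.comp_right _ hm _ (adjoint_mem ha)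
  comp_right m hm b hb := by
    rw [mem_adjointSubmodule, ContinuousLinearMap.adjoint_comp]
    exact hM.comp_left _ (adjoint_mem hb) _ hm
  adjoint_comp m hm n hn := by
    simpa using hM.comp_adjoint _ hm _ hn
  comp_adjoint m hm n hn := by
    simpa using hM.adjoint_comp _ hm _ hn

theorem isCorrespondence_self (A : VonNeumannAlgebra H) :
    IsCorrespondence A A (vnSubmodule A) where
  comp_left _ hb _ hm := comp_mem (A := A) hb hm
  comp_right _ hb _ hm := comp_mem (A := A) hb hm
  adjoint_comp _ hm _ hn := comp_mem (A := A) (adjoint_mem hm) hn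
  comp_adjoint _ hm _ hn := comp_mem (A := A) hm (adjoint_mem hn)

theorem jointlyInjective_self (A : VonNeumannAlgebra H) : JointlyInjective (vnSubmodule A) :=
  fun _ h => h 1 (one_mem A)

/-- The inner factor is absorbed by the bimodule property: `M*(N*N)M ⊆ M*BM ⊆ M*M ⊆ A`, and dually
on the other side. -/
theorem IsCorrespondence.comp {N : Submodule ℂ (K →L[ℂ] L)} {M : Submodule ℂ (H →L[ℂ] K)}
    (hN : IsCorrespondence B C N) (hM : IsCorrespondence A B M) :
    IsCorrespondence A C (compSubmodule N M) := by
  refine IsCorrespondence.span ?_ ?_ ?_ ?_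
  · rintro c hc _ ⟨n, hn, m, hm, rfl⟩
    exact ⟨_, hN.comp_left c hc n hn, m, hm, rfl⟩
  · rintro _ ⟨n, hn, m, hm, rfl⟩ a ha
    exact ⟨n, hn, _, hM.comp_right m hm a ha, rfl⟩
  · rintro _ ⟨n, hn, m, hm, rfl⟩ _ ⟨n', hn', m', hm', rfl⟩
    have h := hM.adjoint_comp m hm _ (hM.comp_left _ (hN.adjoint_comp n hn n' hn') m' hm')
    simpa only [ContinuousLinearMap.adjoint_comp, ContinuousLinearMap.comp_assoc] using h
  · rintro _ ⟨n, hn, m, hm, rfl⟩ _ ⟨n', hn', m', hm', rfl⟩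
    have h := hN.comp_adjoint _ (hN.comp_right n hn _ (hM.comp_adjoint m hm m' hm')) n' hn'
    simpa only [ContinuousLinearMap.adjoint_comp, ContinuousLinearMap.comp_assoc] using h

theorem JointlyInjective.adjoint_comp {N : Submodule ℂ (K →L[ℂ] L)}
    {M : Submodule ℂ (H →L[ℂ] K)} (hN : JointlyInjective (adjointSubmodule N))
    (hM : JointlyInjective (adjointSubmodule M)) :
    JointlyInjective (adjointSubmodule (compSubmodule N M)) := by
  refine fun ξ h => hN ξ fun n hn => hM _ fun m hm => ?_
  refine h (m ∘L n) ?_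
  rw [mem_adjointSubmodule, ContinuousLinearMap.adjoint_comp]
  exact comp_mem_compSubmodule hn hm

theorem JointlyInjective.adjoint_adjoint {M : Submodule ℂ (H →L[ℂ] K)}
    (hM : JointlyInjective M) : JointlyInjective (adjointSubmodule (adjointSubmodule M)) :=
  fun ξ h => hM ξ fun m hm => h m (by simpa [mem_adjointSubmodule] using hm)

/-- A jointly injective correspondence generates the algebra on the right. -/
theorem IsCorrespondence.eq_weakStarSpan {M : Submodule ℂ (H →L[ℂ] K)}
    (hM : IsCorrespondence A B M) (hi : JointlyInjective M) :
    (A : Set (H →L[ℂ] H)) =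
      weakStarSpan {T | ∃ m ∈ M, ∃ b ∈ (B : Set (K →L[ℂ] K)), ∃ n ∈ M,
        T = m.adjoint ∘L b ∘L n} := by
  rw [← coe_vnSubmodule]
  refine Set.Subset.antisymm (fun a ha => ?_) (weakStarSpan_subset (isClosed_vnSubmodule A) ?_)
  · refine hM.isTRO.mem_weakStarSpan hi fun m hm n hn => ?_
    have h1 : (1 : K →L[ℂ] K) ∈ (B : Set (K →L[ℂ] K)) := one_mem B
    -- `a m* n = (m a*)* 1 n`.
    refine ⟨m ∘L a.adjoint, hM.comp_right m hm _ (adjoint_mem ha), 1, h1, n, hn, ?_⟩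
    ext ξ
    simp [ContinuousLinearMap.adjoint_comp]
  · rintro _ ⟨m, hm, b, hb, n, hn, rfl⟩
    exact hM.adjoint_comp m hm _ (hM.comp_left b hb n hn)

/-- Weak TRO-equivalence of von Neumann algebras, in terms of correspondences. -/
theorem troEquiv_iff : TROEquiv (A : Set (H →L[ℂ] H)) (B : Set (K →L[ℂ] K)) ↔
    ∃ M, IsCorrespondence A B M ∧ JointlyInjective M ∧
      JointlyInjective (adjointSubmodule M) := by
  constructor
  · rintro ⟨M, -, hA, hB⟩
    have hA' : ∀ m ∈ M, ∀ b ∈ B, ∀ n ∈ M, m.adjoint ∘L b ∘L n ∈ A := fun m hm b hb n hn => by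
      rw [← SetLike.mem_coe, hA]
      exact subset_weakStarSpan _ ⟨m, hm, b, hb, n, hn, rfl⟩
    have hB' : ∀ m ∈ M, ∀ a ∈ A, ∀ n ∈ M, m ∘L a ∘L n.adjoint ∈ B := fun m hm a ha n hn => by
      rw [← SetLike.mem_coe, hB]
      exact subset_weakStarSpan _ ⟨m, hm, a, ha, n, hn, rfl⟩
    have hS : ∀ m ∈ M, m ∈ Submodule.span ℂ
        {T | ∃ b ∈ B, ∃ m ∈ M, ∃ a ∈ A, T = b ∘L m ∘L a} := fun m hm =>
      Submodule.subset_span ⟨1, one_mem B, m, hm, 1, one_mem A, rfl⟩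
    -- The given `M` need not be a bimodule, so it is replaced by `span BMA`. For instance
    -- `(bma)*(b'm'a') = a*(m* b*b' m')a'`, whose middle factor lies in `M*BM ⊆ A`.
    refine ⟨_, IsCorrespondence.span (S := {T | ∃ b ∈ B, ∃ m ∈ M, ∃ a ∈ A, T = b ∘L m ∘L a})
      ?_ ?_ ?_ ?_, ?_, ?_⟩
    · rintro b' hb' _ ⟨b, hb, m, hm, a, ha, rfl⟩
      exact ⟨_, comp_mem hb' hb, m, hm, a, ha, rfl⟩
    · rintro _ ⟨b, hb, m, hm, a, ha, rfl⟩ a' ha'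
      exact ⟨b, hb, m, hm, _, comp_mem ha ha', rfl⟩
    · rintro _ ⟨b, hb, m, hm, a, ha, rfl⟩ _ ⟨b', hb', m', hm', a', ha', rfl⟩
      have h := comp_mem (comp_mem (adjoint_mem ha)
        (hA' m hm _ (comp_mem (adjoint_mem hb) hb') m' hm')) ha'
      simpa only [ContinuousLinearMap.adjoint_comp, ContinuousLinearMap.comp_assoc] using h
    · rintro _ ⟨b, hb, m, hm, a, ha, rfl⟩ _ ⟨b', hb', m', hm', a', ha', rfl⟩
      have h := comp_mem (comp_mem hb
        (hB' m hm _ (comp_mem ha (adjoint_mem ha')) m' hm')) (adjoint_mem hb')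
      simpa only [ContinuousLinearMap.adjoint_comp, ContinuousLinearMap.comp_assoc] using h
    -- A vector killed by `M` is killed by `M*BM`, hence by its weak-* closed span, which contains
    -- `1`.
    · intro ξ h
      have h1 : (1 : H →L[ℂ] H) ∈ (A : Set (H →L[ℂ] H)) := one_mem A
      rw [hA] at h1
      refine apply_eq_zero_of_mem_weakStarSpan (ξ := ξ) ?_ h1
      rintro _ ⟨m, hm, b, hb, n, hn, rfl⟩
      simp [h n (hS n hn)]
    · intro ξ h
      have h1 : (1 : K →L[ℂ] K) ∈ (B : Set (K →L[ℂ] K)) := one_mem B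
      rw [hB] at h1
      refine apply_eq_zero_of_mem_weakStarSpan (ξ := ξ) ?_ h1
      rintro _ ⟨m, hm, b, hb, n, hn, rfl⟩
      simp [h n.adjoint (adjoint_mem_adjointSubmodule (hS n hn))]
  · rintro ⟨M, hM, hi, hi'⟩
    refine ⟨M, hM.isTRO, hM.eq_weakStarSpan hi, ?_⟩
    refine (hM.adjoint.eq_weakStarSpan hi').trans (congrArg weakStarSpan ?_)
    ext T
    constructor
    · rintro ⟨m, hm, a, ha, n, hn, rfl⟩
      exact ⟨_, hm, a, ha, _, hn, by simp⟩
    · rintro ⟨m, hm, a, ha, n, hn, rfl⟩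
      exact ⟨_, adjoint_mem_adjointSubmodule hm, a, ha, _, adjoint_mem_adjointSubmodule hn,
        by simp⟩

end Correspondence

/-! ### Invariance of orthogonal complements of `MG` -/

section Invariance

variable {H : Type*} [NormedAddCommGroup H] [InnerProductSpace ℂ H] [CompleteSpace H]
variable {K : Type*} [NormedAddCommGroup K] [InnerProductSpace ℂ K] [CompleteSpace K]
variable {A : VonNeumannAlgebra H} {B : VonNeumannAlgebra K}

theorem CommutantInvariant.orthogonal {G : Submodule ℂ H}
    (h : CommutantInvariant A G) : CommutantInvariant A Gᗮ := by
  intro t ht ξ hξ ζ hζ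
  rw [← ContinuousLinearMap.adjoint_inner_left]
  exact hξ _ (h _ (adjoint_mem ht) ζ hζ)

/-- The orthogonal complement of the subspace spanned by `M G`. -/
noncomputable def actPerp (M : Submodule ℂ (H →L[ℂ] K)) (G : Submodule ℂ H) : Submodule ℂ K :=
  (Submodule.span ℂ {η | ∃ m ∈ M, ∃ ξ ∈ G, η = m ξ})ᗮ

instance (M : Submodule ℂ (H →L[ℂ] K)) (G : Submodule ℂ H) : CompleteSpace (actPerp M G) :=
  inferInstanceAs (CompleteSpace (Submodule.span ℂ {η | ∃ m ∈ M, ∃ ξ ∈ G, η = m ξ})ᗮ)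

theorem mem_actPerp {M : Submodule ℂ (H →L[ℂ] K)} {G : Submodule ℂ H} {η : K} :
    η ∈ actPerp M G ↔ ∀ m ∈ M, m.adjoint η ∈ Gᗮ := by
  rw [actPerp, Submodule.mem_orthogonal]
  constructor
  · intro h m hm ξ hξ
    rw [ContinuousLinearMap.adjoint_inner_right]
    exact h _ (Submodule.subset_span ⟨m, hm, ξ, hξ, rfl⟩)
  · intro h u hu
    induction hu using Submodule.span_induction with
    | mem u hu =>
      obtain ⟨m, hm, ξ, hξ, rfl⟩ := hu
      rw [← ContinuousLinearMap.adjoint_inner_right]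
      exact h m hm ξ hξ
    | zero => simp
    | add u v _ _ hu hv => rw [inner_add_left, hu, hv, add_zero]
    | smul c u _ hu => rw [inner_smul_left, hu, mul_zero]

theorem actPerp_antitone (M : Submodule ℂ (H →L[ℂ] K)) : Antitone (actPerp M) :=
  fun _ _ h _ hη => mem_actPerp.2 fun m hm => Submodule.orthogonal_le h (mem_actPerp.1 hη m hm)

omit [CompleteSpace H] [CompleteSpace K] in
theorem apply_mem_orthogonal_actPerp {M : Submodule ℂ (H →L[ℂ] K)} {G : Submodule ℂ H}
    {m : H →L[ℂ] K} (hm : m ∈ M) {ξ : H} (hξ : ξ ∈ G) : m ξ ∈ (actPerp M G)ᗮ :=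
  Submodule.le_orthogonal_orthogonal _ (Submodule.subset_span ⟨m, hm, ξ, hξ, rfl⟩)

variable {M : Submodule ℂ (H →L[ℂ] K)}

/-- Since `BM ⊆ M`, the span of `MG` is `B`-invariant, and `B` is self-adjoint. This places the
projection onto `(MG)ᗮ` in the commutant of `B`. -/
theorem IsCorrespondence.apply_mem_actPerp (hM : IsCorrespondence A B M) (G : Submodule ℂ H)
    {b : K →L[ℂ] K} (hb : b ∈ B) {η : K} (hη : η ∈ actPerp M G) : b η ∈ actPerp M G := by
  rw [mem_actPerp] at hη ⊢
  intro m hm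
  have h := hη _ (hM.comp_left _ (adjoint_mem hb) m hm)
  rwa [ContinuousLinearMap.adjoint_comp, ContinuousLinearMap.adjoint_adjoint] at h

/-- With `g` the projection onto the closure of `G`, `η ⊥ MG` means `g m*η = 0` for all `m`. As `m g
m* ∈ B` commutes with `t`, `m g m* tη = t m g m* η = 0`, and then `‖g m* tη‖² = ⟪tη, m g m* tη⟫ =
0`. -/
theorem IsCorrespondence.commutantInvariant_actPerp (hM : IsCorrespondence A B M)
    {G : Submodule ℂ H} (hG : CommutantInvariant A G) : CommutantInvariant B (actPerp M G) := by
  intro t ht η hη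
  let g := G.topologicalClosure.starProjection
  have hg : g ∈ A := hG.topologicalClosure.starProjection_mem
  have hg' : g.adjoint = g := (isSelfAdjoint_starProjection _).adjoint_eq
  have hker : ∀ ζ, g ζ = 0 ↔ ζ ∈ Gᗮ := fun ζ => by
    rw [← Submodule.orthogonal_closure]
    exact Submodule.starProjection_apply_eq_zero_iff _
  have hgg : ∀ ζ, g (g ζ) = g ζ := fun ζ =>
    Submodule.starProjection_eq_self_iff.2 (Submodule.starProjection_apply_mem _ _)
  rw [mem_actPerp] at hη ⊢
  intro m hm
  rw [← hker]
  have hT := hM.comp_adjoint _ (hM.comp_right m hm g hg) m hm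
  have hc := congrArg (fun S : K →L[ℂ] K => S η) (VonNeumannAlgebra.mem_commutant_iff.1 ht _ hT)
  have h0 : m (g (m.adjoint (t η))) = 0 := by
    have h1 : g (m.adjoint η) = 0 := (hker _).2 (hη m hm)
    simpa [h1] using hc
  rw [← inner_self_eq_zero (𝕜 := ℂ), ← ContinuousLinearMap.adjoint_inner_right, hg', hgg,
    ContinuousLinearMap.adjoint_inner_left, h0, inner_zero_right]

theorem commutantInvariant_top : CommutantInvariant A ⊤ := fun _ _ _ _ => trivial

/-- The projection onto an invariant subspace of `A` lies in the commutant. -/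
theorem starProjection_mem_commutant {G : Submodule ℂ H} [CompleteSpace G]
    (h : ∀ a ∈ A, ∀ ξ ∈ G, a ξ ∈ G) : G.starProjection ∈ A.commutant := by
  refine CommutantInvariant.starProjection_mem fun t ht => h t ?_
  rwa [VonNeumannAlgebra.commutant_commutant] at ht

end Invariance

/-! ### Corners and weak TRO-embeddings -/

section Corner

variable {H : Type*} [NormedAddCommGroup H] [InnerProductSpace ℂ H] [CompleteSpace H]
variable {K : Type*} [NormedAddCommGroup K] [InnerProductSpace ℂ K] [CompleteSpace K]
variable {A : VonNeumannAlgebra H} {B : VonNeumannAlgebra K}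

theorem subtypeL_adjoint_apply {p : H →L[ℂ] H} (hp : IsStarProjection p) [CompleteSpace p.range]
    (ξ : H) : (p.range.subtypeL.adjoint ξ : H) = p ξ := by
  obtain ⟨h, hp'⟩ := isStarProjection_iff_eq_starProjection_range.1 hp
  rw [Submodule.adjoint_subtypeL]
  exact (congrArg (fun q : H →L[ℂ] H => q ξ) hp').symm

theorem subtypeL_adjoint_coe (U : Submodule ℂ H) [CompleteSpace U] (ξ : U) :
    U.subtypeL.adjoint (ξ : H) = ξ := by
  rw [Submodule.adjoint_subtypeL]
  exact Submodule.orthogonalProjectionOnto_mem_subspace_eq_self ξ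

/-- The corner consists of the operators whose extension by zero lies in the algebra. -/
theorem mem_corner_iff {p : H →L[ℂ] H} (hp : IsStarProjection p) (hpA : p ∈ A)
    [CompleteSpace p.range] {b : p.range →L[ℂ] p.range} :
    b ∈ corner (A : Set (H →L[ℂ] H)) p ↔
      p.range.subtypeL ∘L b ∘L p.range.subtypeL.adjoint ∈ A := by
  constructor
  · rintro ⟨a, ha, h⟩
    -- With `i` the inclusion of `p(H)`, `i b i* = p a p`.
    convert comp_mem hpA (comp_mem (A := A) ha hpA) using 1
    ext ξ
    simp [h, subtypeL_adjoint_apply hp]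
  · intro h
    refine ⟨_, h, fun ξ => ?_⟩
    simp only [ContinuousLinearMap.comp_apply, Submodule.subtypeL_apply, subtypeL_adjoint_coe]
    rw [← subtypeL_adjoint_apply hp, subtypeL_adjoint_coe]

theorem compression_mem_corner {p : H →L[ℂ] H} (hp : IsStarProjection p)
    [CompleteSpace p.range] {a : H →L[ℂ] H} (ha : a ∈ A) :
    p.range.subtypeL.adjoint ∘L a ∘L p.range.subtypeL ∈ corner (A : Set (H →L[ℂ] H)) p :=
  ⟨a, ha, fun ξ => by simp [subtypeL_adjoint_apply hp]⟩

/-- The corner `pAp` as a linear subspace. -/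
noncomputable def cornerSubmodule (A : VonNeumannAlgebra H) (p : H →L[ℂ] H)
    [CompleteSpace p.range] : Submodule ℂ (p.range →L[ℂ] p.range) where
  carrier := {b | p.range.subtypeL ∘L b ∘L p.range.subtypeL.adjoint ∈ vnSubmodule A}
  zero_mem' := by simp
  add_mem' ha hb := by simpa using Submodule.add_mem _ ha hb
  smul_mem' c _ hb := by simpa using Submodule.smul_mem _ c hb

theorem isClosed_cornerSubmodule (A : VonNeumannAlgebra H) (p : H →L[ℂ] H)
    [CompleteSpace p.range] :
    IsClosed[weakStarTopology p.range p.range]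
      (cornerSubmodule A p : Set (p.range →L[ℂ] p.range)) :=
  @IsClosed.preimage _ _ (weakStarTopology p.range p.range) (weakStarTopology H H) _
    (continuous_weakStar_comp p.range.subtypeL p.range.subtypeL.adjoint) _
    (isClosed_vnSubmodule A)

theorem coe_cornerSubmodule {p : H →L[ℂ] H} (hp : IsStarProjection p) (hpA : p ∈ A)
    [CompleteSpace p.range] :
    (cornerSubmodule A p : Set (p.range →L[ℂ] p.range)) = corner (A : Set (H →L[ℂ] H)) p :=
  Set.ext fun _ => (mem_corner_iff hp hpA).symm

theorem exists_correspondence_of_troEmbeds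
    (h : TROEmbeds (A : Set (H →L[ℂ] H)) (B : Set (K →L[ℂ] K))) :
    ∃ M, IsCorrespondence A B M ∧ JointlyInjective M := by
  obtain ⟨p, hpB, hp, h⟩ := h
  have : CompleteSpace p.range := completeSpace_range hp
  obtain ⟨M, -, hA, hB⟩ := h
  let i := p.range.subtypeL
  have hA' : ∀ m ∈ M, ∀ b ∈ corner (B : Set (K →L[ℂ] K)) p, ∀ n ∈ M,
      m.adjoint ∘L b ∘L n ∈ A := fun m hm b hb n hn => by
    rw [← SetLike.mem_coe, hA]
    exact subset_weakStarSpan _ ⟨m, hm, b, hb, n, hn, rfl⟩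
  have hB' : ∀ m ∈ M, ∀ a ∈ A, ∀ n ∈ M, i ∘L (m ∘L a ∘L n.adjoint) ∘L i.adjoint ∈ B :=
    fun m hm a ha n hn => by
      rw [← mem_corner_iff hp hpB, hB]
      exact subset_weakStarSpan _ ⟨m, hm, a, ha, n, hn, rfl⟩
  -- The bimodule is `span BiMA`, with `i` the inclusion of `p(K)`. In `(b i m a)*(b' i m' a')` the
  -- factor `i* b*b' i` is a compression, so it lies in the corner.
  refine ⟨_, IsCorrespondence.span (S := {T | ∃ b ∈ B, ∃ m ∈ M, ∃ a ∈ A, T = b ∘L i ∘L m ∘L a})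
    ?_ ?_ ?_ ?_, ?_⟩
  · rintro b' hb' _ ⟨b, hb, m, hm, a, ha, rfl⟩
    exact ⟨_, comp_mem hb' hb, m, hm, a, ha, rfl⟩
  · rintro _ ⟨b, hb, m, hm, a, ha, rfl⟩ a' ha'
    exact ⟨b, hb, m, hm, _, comp_mem ha ha', rfl⟩
  · rintro _ ⟨b, hb, m, hm, a, ha, rfl⟩ _ ⟨b', hb', m', hm', a', ha', rfl⟩
    have h := comp_mem (comp_mem (adjoint_mem ha)
      (hA' m hm _ (compression_mem_corner hp (comp_mem (adjoint_mem hb) hb')) m' hm')) ha'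
    simpa only [ContinuousLinearMap.adjoint_comp, ContinuousLinearMap.comp_assoc] using h
  · rintro _ ⟨b, hb, m, hm, a, ha, rfl⟩ _ ⟨b', hb', m', hm', a', ha', rfl⟩
    have h := comp_mem (comp_mem hb
      (hB' m hm _ (comp_mem ha (adjoint_mem ha')) m' hm')) (adjoint_mem hb')
    simpa only [ContinuousLinearMap.adjoint_comp, ContinuousLinearMap.comp_assoc] using h
  · intro ξ h
    have h1 : (1 : H →L[ℂ] H) ∈ (A : Set (H →L[ℂ] H)) := one_mem A
    rw [hA] at h1
    refine apply_eq_zero_of_mem_weakStarSpan (ξ := ξ) ?_ h1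
    rintro _ ⟨m, hm, b, hb, n, hn, rfl⟩
    have hn' : i (n ξ) = 0 :=
      h (i ∘L n) (Submodule.subset_span ⟨1, one_mem B, n, hn, 1, one_mem A, rfl⟩)
    have hn0 : n ξ = 0 := Subtype.ext hn'
    simp [hn0]

/-- The operators into a closed subspace `U` whose extension to the ambient space lies in `M`. -/
def codRestrictSubmodule (M : Submodule ℂ (H →L[ℂ] K)) (U : Submodule ℂ K) :
    Submodule ℂ (H →L[ℂ] U) where
  carrier := {T | U.subtypeL ∘L T ∈ M}
  zero_mem' := by simp
  add_mem' ha hb := by simpa using M.add_mem ha hb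
  smul_mem' c _ hb := by simpa using M.smul_mem c hb

omit [CompleteSpace H] [CompleteSpace K] in
theorem mem_codRestrictSubmodule {M : Submodule ℂ (H →L[ℂ] K)} {U : Submodule ℂ K}
    {T : H →L[ℂ] U} : T ∈ codRestrictSubmodule M U ↔ U.subtypeL ∘L T ∈ M := Iff.rfl

theorem IsTRO.codRestrict {M : Submodule ℂ (H →L[ℂ] K)} (hM : IsTRO M) (U : Submodule ℂ K)
    [CompleteSpace U] : IsTRO (codRestrictSubmodule M U) := by
  intro a ha b hb c hc
  rw [mem_codRestrictSubmodule]
  convert hM _ ha _ hb _ hc using 1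
  ext ξ
  simp [ContinuousLinearMap.adjoint_comp, subtypeL_adjoint_coe]

theorem troEmbeds_of_correspondence {M : Submodule ℂ (H →L[ℂ] K)}
    (hM : IsCorrespondence A B M) (hi : JointlyInjective M) :
    TROEmbeds (A : Set (H →L[ℂ] H)) (B : Set (K →L[ℂ] K)) := by
  -- `p` projects onto the closed span of `MH`. Viewing `M` as operators into `p(K)` removes the
  -- common kernel of `M*`.
  obtain ⟨p, hp, hpB, hpr⟩ : ∃ p : K →L[ℂ] K, IsStarProjection p ∧ p ∈ B ∧
      p.range = (actPerp M ⊤)ᗮ :=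
    ⟨(actPerp M ⊤)ᗮ.starProjection, isStarProjection_starProjection,
      (hM.commutantInvariant_actPerp commutantInvariant_top).orthogonal.starProjection_mem,
      Submodule.range_starProjection _⟩
  have : CompleteSpace p.range := completeSpace_range hp
  let i := p.range.subtypeL
  have hpm : ∀ m ∈ M, i ∘L i.adjoint ∘L m = m := by
    intro m hm
    ext ξ
    have h : m ξ ∈ p.range := hpr ▸ apply_mem_orthogonal_actPerp hm trivial
    exact congrArg Subtype.val (subtypeL_adjoint_coe p.range ⟨m ξ, h⟩)
  let N := codRestrictSubmodule M p.range
  have hN : IsTRO N := hM.isTRO.codRestrict _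
  have hmN : ∀ m ∈ M, i.adjoint ∘L m ∈ N := fun m hm => by
    rw [mem_codRestrictSubmodule]
    exact (hpm m hm).symm ▸ hm
  have hNi : JointlyInjective N := fun ξ h => hi ξ fun m hm => by
    have h1 := congrArg i (h _ (hmN m hm))
    rw [map_zero] at h1
    rw [← hpm m hm]
    exact h1
  have hNi' : JointlyInjective (adjointSubmodule N) := fun ξ h => by
    have h1 : (ξ : K) ∈ actPerp M ⊤ := mem_actPerp.2 fun m hm => by
      have h2 := h _ (adjoint_mem_adjointSubmodule (hmN m hm))
      rw [ContinuousLinearMap.adjoint_comp, ContinuousLinearMap.adjoint_adjoint] at h2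
      have h3 : m.adjoint (ξ : K) = 0 := h2
      rw [h3]
      exact Submodule.zero_mem _
    have h2 : (ξ : K) ∈ (actPerp M ⊤)ᗮ := hpr ▸ ξ.2
    exact Subtype.ext (inner_self_eq_zero.1 (h2 _ h1))
  refine ⟨p, hpB, hp, N, hN, ?_, ?_⟩
  · rw [← coe_vnSubmodule]
    refine Set.Subset.antisymm (fun a ha => ?_) (weakStarSpan_subset (isClosed_vnSubmodule A) ?_)
    · refine hN.mem_weakStarSpan hNi fun m hm n hn => ?_
      have h1 : (1 : p.range →L[ℂ] p.range) ∈ corner (B : Set (K →L[ℂ] K)) p :=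
        ⟨p, hpB, fun ξ => by
          rw [← subtypeL_adjoint_apply hp, ← subtypeL_adjoint_apply hp, subtypeL_adjoint_coe,
            subtypeL_adjoint_coe]
          rfl⟩
      refine ⟨m ∘L a.adjoint, hM.comp_right _ hm _ (adjoint_mem ha), 1, h1, n, hn, ?_⟩
      ext ξ
      simp [ContinuousLinearMap.adjoint_comp]
    · rintro _ ⟨m, hm, b, hb, n, hn, rfl⟩
      have hb' := (mem_corner_iff hp hpB).1 hb
      have h := hM.adjoint_comp _ hm _ (hM.comp_left _ hb' _ hn)
      rw [coe_vnSubmodule, SetLike.mem_coe]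
      convert h using 1
      ext ξ
      simp [ContinuousLinearMap.adjoint_comp, subtypeL_adjoint_coe]
  · rw [← coe_cornerSubmodule hp hpB]
    refine Set.Subset.antisymm (fun b hb => ?_)
      (weakStarSpan_subset (isClosed_cornerSubmodule B p) ?_)
    · refine hN.adjoint.mem_weakStarSpan hNi' fun m hm n hn => ?_
      have h1 : (1 : H →L[ℂ] H) ∈ (A : Set (H →L[ℂ] H)) := one_mem A
      -- Here `m`, `n` range over `N*`, and `b m* n = (b m*) 1 (n*)*`. The factor `b m*` is in `N`
      -- because `i b m* = (i b i*)(i m*)` with `i b i* ∈ B`.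
      refine ⟨b ∘L m.adjoint, ?_, 1, h1, n.adjoint, hn, ?_⟩
      · rw [mem_codRestrictSubmodule]
        convert hM.comp_left _ hb _ hm using 1
        ext ξ
        simp [subtypeL_adjoint_coe]
      · ext ξ
        simp
    · rintro _ ⟨m, hm, a, ha, n, hn, rfl⟩
      have h := hM.comp_adjoint _ (hM.comp_right _ hm a ha) _ hn
      rw [ContinuousLinearMap.adjoint_comp] at h
      exact h

/-- Weak TRO-embedding of von Neumann algebras, in terms of correspondences. -/
theorem troEmbeds_iff : TROEmbeds (A : Set (H →L[ℂ] H)) (B : Set (K →L[ℂ] K)) ↔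
    ∃ M, IsCorrespondence A B M ∧ JointlyInjective M :=
  ⟨exists_correspondence_of_troEmbeds, fun ⟨_, hM, hi⟩ => troEmbeds_of_correspondence hM hi⟩

end Corner

/-! ### The Cantor–Bernstein argument -/

section CantorBernstein

variable {H : Type*} [NormedAddCommGroup H] [InnerProductSpace ℂ H] [CompleteSpace H]
variable {K : Type*} [NormedAddCommGroup K] [InnerProductSpace ℂ K] [CompleteSpace K]
variable {A : VonNeumannAlgebra H} {B : VonNeumannAlgebra K}

/-- A decomposition of `H` and `K` into central summands, matched crosswise by two
correspondences. -/
theorem exists_central_decomposition {M : Submodule ℂ (H →L[ℂ] K)} {N : Submodule ℂ (K →L[ℂ] H)}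
    (hM : IsCorrespondence A B M) (hN : IsCorrespondence B A N) :
    ∃ (G : Submodule ℂ H) (F : Submodule ℂ K), F = actPerp M G ∧ G = actPerp N F ∧
      CommutantInvariant A G ∧ CommutantInvariant B F := by
  -- A composite of two antitone maps is monotone, so it has a least fixed point. Commutant
  -- invariance passes to that point because it survives both `Φ` and suprema.
  let Φ : Submodule ℂ H →o Submodule ℂ H :=
    ⟨fun G => actPerp N (actPerp M G), (actPerp_antitone N).comp (actPerp_antitone M)⟩
  have hG : CommutantInvariant A Φ.lfp :=
    Φ.lfp_induction (p := CommutantInvariant A)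
      (fun _ h _ => hN.commutantInvariant_actPerp (hM.commutantInvariant_actPerp h))
      (fun _ h => CommutantInvariant.sSup h)
  exact ⟨Φ.lfp, _, rfl, Φ.map_lfp.symm, hG, hM.commutantInvariant_actPerp hG⟩

theorem exists_correspondence_of_injective {M : Submodule ℂ (H →L[ℂ] K)}
    {N : Submodule ℂ (K →L[ℂ] H)} (hM : IsCorrespondence A B M) (hMi : JointlyInjective M)
    (hN : IsCorrespondence B A N) (hNi : JointlyInjective N) :
    ∃ P : Submodule ℂ (H →L[ℂ] K), IsCorrespondence A B P ∧ JointlyInjective P ∧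
      JointlyInjective (adjointSubmodule P) := by
  obtain ⟨G, F, hF, hG, hGA, hFB⟩ := exists_central_decomposition hM hN
  have : CompleteSpace G := hG ▸ inferInstance
  have : CompleteSpace F := hF ▸ inferInstance
  let g := G.starProjection
  let f := F.starProjection
  have hgA : g ∈ A := hGA.starProjection_mem
  have hfB : f ∈ B := hFB.starProjection_mem
  -- The fixed-point equations write `G` and `F` as complements of `NF` and `MG`, which makes them
  -- invariant under the algebras as well; `g` and `f` are therefore central.
  have hgA' : g ∈ A.commutant := starProjection_mem_commutant fun a ha ξ hξ => by
    rw [hG] at hξ ⊢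
    exact hN.apply_mem_actPerp F ha hξ
  have hfB' : f ∈ B.commutant := starProjection_mem_commutant fun b hb ξ hξ => by
    rw [hF] at hξ ⊢
    exact hM.apply_mem_actPerp G hb hξ
  have hga : ∀ a ∈ A, ∀ ξ, a (g ξ) = g (a ξ) := fun a ha ξ =>
    congrArg (fun S : H →L[ℂ] H => S ξ) (VonNeumannAlgebra.mem_commutant_iff.1 hgA' a ha)
  have hfb : ∀ b ∈ B, ∀ η, b (f η) = f (b η) := fun b hb η =>
    congrArg (fun S : K →L[ℂ] K => S η) (VonNeumannAlgebra.mem_commutant_iff.1 hfB' b hb)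
  have hg' : g.adjoint = g := (isSelfAdjoint_starProjection _).adjoint_eq
  have hf' : f.adjoint = f := (isSelfAdjoint_starProjection _).adjoint_eq
  have hfmg : ∀ m ∈ M, ∀ ξ, f (m (g ξ)) = 0 := fun m hm ξ => by
    refine (Submodule.starProjection_apply_eq_zero_iff _).2 ?_
    rw [hF]
    exact apply_mem_orthogonal_actPerp hm (Submodule.starProjection_apply_mem _ _)
  have hgnf : ∀ n ∈ N, ∀ η, g (n (f η)) = 0 := fun n hn η => by
    refine (Submodule.starProjection_apply_eq_zero_iff _).2 ?_
    rw [hG]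
    exact apply_mem_orthogonal_actPerp hn (Submodule.starProjection_apply_mem _ _)
  have hgmf : ∀ m ∈ M, ∀ η, g (m.adjoint (f η)) = 0 := fun m hm η => by
    refine ext_inner_right ℂ fun ζ => ?_
    rw [← hg', ContinuousLinearMap.adjoint_inner_left, ContinuousLinearMap.adjoint_inner_left,
      ← hf', ContinuousLinearMap.adjoint_inner_left, hfmg m hm, inner_zero_right, inner_zero_left]
  have hfng : ∀ n ∈ N, ∀ ξ, f (n.adjoint (g ξ)) = 0 := fun n hn ξ => by
    refine ext_inner_right ℂ fun ζ => ?_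
    rw [← hf', ContinuousLinearMap.adjoint_inner_left, ContinuousLinearMap.adjoint_inner_left,
      ← hg', ContinuousLinearMap.adjoint_inner_left, hgnf n hn, inner_zero_right, inner_zero_left]
  have hgg : ∀ ξ, g (g ξ) = g ξ := fun ξ =>
    Submodule.starProjection_eq_self_iff.2 (Submodule.starProjection_apply_mem _ _)
  have hff : ∀ η, f (f η) = f η := fun η =>
    Submodule.starProjection_eq_self_iff.2 (Submodule.starProjection_apply_mem _ _)
  have hadj : ∀ (m : H →L[ℂ] K) (n : K →L[ℂ] H),
      (m ∘L g + f ∘L n.adjoint).adjoint = g ∘L m.adjoint + n ∘L f := fun m n => by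
    rw [map_add, ContinuousLinearMap.adjoint_comp, ContinuousLinearMap.adjoint_comp,
      ContinuousLinearMap.adjoint_adjoint, hg', hf']
  -- Centrality makes `S` stable under both algebras. In products such as `(mg + fn*)*(m'g + fn'*)`
  -- the cross terms vanish, since `fMg = 0` and `gNf = 0`.
  let S : Set (H →L[ℂ] K) := {T | ∃ m ∈ M, ∃ n ∈ N, T = m ∘L g + f ∘L n.adjoint}
  have hSM : ∀ m ∈ M, m ∘L g ∈ S := fun m hm => ⟨m, hm, 0, N.zero_mem, by simp⟩
  have hSN : ∀ n ∈ N, f ∘L n.adjoint ∈ S := fun n hn => ⟨0, M.zero_mem, n, hn, by simp⟩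
  refine ⟨Submodule.span ℂ S, IsCorrespondence.span ?_ ?_ ?_ ?_, fun ξ h => ?_, fun η h => ?_⟩
  · rintro b hb _ ⟨m, hm, n, hn, rfl⟩
    refine ⟨_, hM.comp_left b hb m hm, _, hN.comp_right n hn _ (adjoint_mem hb), ?_⟩
    ext ξ
    simp [ContinuousLinearMap.adjoint_comp, hfb b hb]
  · rintro _ ⟨m, hm, n, hn, rfl⟩ a ha
    refine ⟨_, hM.comp_right m hm a ha, _, hN.comp_left _ (adjoint_mem ha) n hn, ?_⟩
    ext ξ
    simp [ContinuousLinearMap.adjoint_comp, hga a ha]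
  · rintro _ ⟨m, hm, n, hn, rfl⟩ _ ⟨m', hm', n', hn', rfl⟩
    convert add_mem (comp_mem hgA (comp_mem (hM.adjoint_comp m hm m' hm') hgA))
      (hN.comp_adjoint _ (hN.comp_right n hn f hfB) n' hn') using 1
    ext ξ
    simp [hadj, hfmg m' hm', hgmf m hm, hff]
  · rintro _ ⟨m, hm, n, hn, rfl⟩ _ ⟨m', hm', n', hn', rfl⟩
    convert add_mem (hM.comp_adjoint _ (hM.comp_right m hm g hgA) m' hm')
      (comp_mem hfB (comp_mem (hN.adjoint_comp n hn n' hn') hfB)) using 1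
    ext ξ
    simp [hadj, hgnf n' hn', hfng n hn, hgg]
  -- `Mgξ = 0` forces `gξ = 0`, while `fN*ξ = 0` says `ξ ⊥ NF`, that is `ξ ∈ G`; together `ξ = gξ =
  -- 0`. The adjoint side is the same with the roles exchanged.
  · have h1 : g ξ = 0 := hMi _ fun m hm => h _ (Submodule.subset_span (hSM m hm))
    have h2 : ξ ∈ G := by
      rw [hG, mem_actPerp]
      exact fun n hn => (Submodule.starProjection_apply_eq_zero_iff _).1
        (h _ (Submodule.subset_span (hSN n hn)))
    rwa [← Submodule.starProjection_eq_self_iff.2 h2]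
  · have h1 : f η = 0 := hNi _ fun n hn => by
      have := h _ (adjoint_mem_adjointSubmodule (Submodule.subset_span (hSN n hn)))
      rwa [ContinuousLinearMap.adjoint_comp, ContinuousLinearMap.adjoint_adjoint, hf'] at this
    have h2 : η ∈ F := by
      rw [hF, mem_actPerp]
      intro m hm
      have := h _ (adjoint_mem_adjointSubmodule (Submodule.subset_span (hSM m hm)))
      rw [ContinuousLinearMap.adjoint_comp, hg'] at this
      exact (Submodule.starProjection_apply_eq_zero_iff _).1 this
    rwa [← Submodule.starProjection_eq_self_iff.2 h2]

end CantorBernstein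

/-! ### Order properties deduced from correspondences -/

section Main

variable {H : Type*} [NormedAddCommGroup H] [InnerProductSpace ℂ H] [CompleteSpace H]
variable {K : Type*} [NormedAddCommGroup K] [InnerProductSpace ℂ K] [CompleteSpace K]
variable {L : Type*} [NormedAddCommGroup L] [InnerProductSpace ℂ L] [CompleteSpace L]
variable {A : VonNeumannAlgebra H} {B : VonNeumannAlgebra K} {C : VonNeumannAlgebra L}

theorem TROEquiv.refl (A : VonNeumannAlgebra H) :
    TROEquiv (A : Set (H →L[ℂ] H)) (A : Set (H →L[ℂ] H)) :=
  troEquiv_iff.2 ⟨_, isCorrespondence_self A, jointlyInjective_self A, fun _ h =>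
    h 1 (by rw [mem_adjointSubmodule, ContinuousLinearMap.adjoint_one]; exact one_mem A)⟩

theorem TROEquiv.symm (h : TROEquiv (A : Set (H →L[ℂ] H)) (B : Set (K →L[ℂ] K))) :
    TROEquiv (B : Set (K →L[ℂ] K)) (A : Set (H →L[ℂ] H)) := by
  obtain ⟨M, hM, hi, hi'⟩ := troEquiv_iff.1 h
  exact troEquiv_iff.2 ⟨_, hM.adjoint, hi', hi.adjoint_adjoint⟩

theorem TROEquiv.trans (h : TROEquiv (A : Set (H →L[ℂ] H)) (B : Set (K →L[ℂ] K)))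
    (h' : TROEquiv (B : Set (K →L[ℂ] K)) (C : Set (L →L[ℂ] L))) :
    TROEquiv (A : Set (H →L[ℂ] H)) (C : Set (L →L[ℂ] L)) := by
  obtain ⟨M, hM, hi, hi'⟩ := troEquiv_iff.1 h
  obtain ⟨N, hN, hj, hj'⟩ := troEquiv_iff.1 h'
  exact troEquiv_iff.2 ⟨_, hN.comp hM, hj.comp hi, hj'.adjoint_comp hi'⟩

theorem TROEquiv.troEmbeds (h : TROEquiv (A : Set (H →L[ℂ] H)) (B : Set (K →L[ℂ] K))) :
    TROEmbeds (A : Set (H →L[ℂ] H)) (B : Set (K →L[ℂ] K)) := by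
  obtain ⟨M, hM, hi, -⟩ := troEquiv_iff.1 h
  exact troEmbeds_iff.2 ⟨M, hM, hi⟩

theorem TROEmbeds.trans (h : TROEmbeds (A : Set (H →L[ℂ] H)) (B : Set (K →L[ℂ] K)))
    (h' : TROEmbeds (B : Set (K →L[ℂ] K)) (C : Set (L →L[ℂ] L))) :
    TROEmbeds (A : Set (H →L[ℂ] H)) (C : Set (L →L[ℂ] L)) := by
  obtain ⟨M, hM, hi⟩ := troEmbeds_iff.1 h
  obtain ⟨N, hN, hj⟩ := troEmbeds_iff.1 h'
  exact troEmbeds_iff.2 ⟨_, hN.comp hM, hj.comp hi⟩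

/-- Cantor–Bernstein theorem for weak TRO-embeddings. -/
theorem TROEmbeds.antisymm (h : TROEmbeds (A : Set (H →L[ℂ] H)) (B : Set (K →L[ℂ] K)))
    (h' : TROEmbeds (B : Set (K →L[ℂ] K)) (A : Set (H →L[ℂ] H))) :
    TROEquiv (A : Set (H →L[ℂ] H)) (B : Set (K →L[ℂ] K)) := by
  obtain ⟨M, hM, hi⟩ := troEmbeds_iff.1 h
  obtain ⟨N, hN, hj⟩ := troEmbeds_iff.1 h'
  exact troEquiv_iff.2 (exists_correspondence_of_injective hM hi hN hj)

end Main

end TROMorita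

theorem mainTheorem4
    {H : Type*} [NormedAddCommGroup H] [InnerProductSpace ℂ H] [CompleteSpace H]
    {K : Type*} [NormedAddCommGroup K] [InnerProductSpace ℂ K] [CompleteSpace K]
    {L : Type*} [NormedAddCommGroup L] [InnerProductSpace ℂ L] [CompleteSpace L]
    (A : VonNeumannAlgebra H) (B : VonNeumannAlgebra K) (C : VonNeumannAlgebra L) :
    -- weak TRO-equivalence is an equivalence relation
    (TROMorita.TROEquiv (A : Set (H →L[ℂ] H)) (A : Set (H →L[ℂ] H)) ∧
      (TROMorita.TROEquiv (A : Set (H →L[ℂ] H)) (B : Set (K →L[ℂ] K)) →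
        TROMorita.TROEquiv (B : Set (K →L[ℂ] K)) (A : Set (H →L[ℂ] H))) ∧
      (TROMorita.TROEquiv (A : Set (H →L[ℂ] H)) (B : Set (K →L[ℂ] K)) →
        TROMorita.TROEquiv (B : Set (K →L[ℂ] K)) (C : Set (L →L[ℂ] L)) →
        TROMorita.TROEquiv (A : Set (H →L[ℂ] H)) (C : Set (L →L[ℂ] L)))) ∧
    -- weak TRO-embedding depends only on the equivalence classes
    ((TROMorita.TROEquiv (A : Set (H →L[ℂ] H)) (B : Set (K →L[ℂ] K)) →
        (TROMorita.TROEmbeds (A : Set (H →L[ℂ] H)) (C : Set (L →L[ℂ] L)) ↔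
          TROMorita.TROEmbeds (B : Set (K →L[ℂ] K)) (C : Set (L →L[ℂ] L)))) ∧
      (TROMorita.TROEquiv (A : Set (H →L[ℂ] H)) (B : Set (K →L[ℂ] K)) →
        (TROMorita.TROEmbeds (C : Set (L →L[ℂ] L)) (A : Set (H →L[ℂ] H)) ↔
          TROMorita.TROEmbeds (C : Set (L →L[ℂ] L)) (B : Set (K →L[ℂ] K))))) ∧
    -- reflexivity, transitivity, and antisymmetry up to weak TRO-equivalence
    (TROMorita.TROEmbeds (A : Set (H →L[ℂ] H)) (A : Set (H →L[ℂ] H)) ∧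
      (TROMorita.TROEmbeds (C : Set (L →L[ℂ] L)) (B : Set (K →L[ℂ] K)) →
        TROMorita.TROEmbeds (B : Set (K →L[ℂ] K)) (A : Set (H →L[ℂ] H)) →
        TROMorita.TROEmbeds (C : Set (L →L[ℂ] L)) (A : Set (H →L[ℂ] H))) ∧
      (TROMorita.TROEmbeds (A : Set (H →L[ℂ] H)) (B : Set (K →L[ℂ] K)) →
        TROMorita.TROEmbeds (B : Set (K →L[ℂ] K)) (A : Set (H →L[ℂ] H)) →
        TROMorita.TROEquiv (A : Set (H →L[ℂ] H)) (B : Set (K →L[ℂ] K)))) := by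
  refine ⟨⟨TROMorita.TROEquiv.refl A, fun h => h.symm, fun h h' => h.trans h'⟩,
    ⟨fun h => ⟨fun h' => h.symm.troEmbeds.trans h', fun h' => h.troEmbeds.trans h'⟩,
      fun h => ⟨fun h' => h'.trans h.troEmbeds, fun h' => h'.trans h.symm.troEmbeds⟩⟩,
    (TROMorita.TROEquiv.refl A).troEmbeds, fun h h' => h.trans h', fun h h' => h.antisymm h'⟩
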